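/- For every integer $m\ge 1$ there is a constant $C=C(m)$ with the following property. Let $\delta>0$ and put $\epsilon=\delta^{C}$. Let $V$ be a finite-dimensional vector space over a finite field $k$, let $H$ be an abelian group, and let $X\subset V$ be a subset of density $|X|/|V|>\delta$ which is $(\epsilon,m)$-uniform, i.e. $\|1_X-\mathbb E 1_X\|_{U_m}<\epsilon$. Here, for $g:V\to\mathbb C$, $\|g\|_{U_m}$ is the Gowers norm $$\|g\|_{U_m}^{2^m}=\mathbb E_{x,v_1,\dots,v_m\in V}\prod_{\omega\in\{0,1\}^m}g^{\omega}\Big(x+\sum_{i=1}^m\omega_iv_i\Big),$$ where $g^\omega=g$ if $|\omega|=\sum_i\omega_i$ is even and $g^\omega=\bar g$ otherwise. Let $f:X\to H$ satisfy $$\sum_{\omega\in\{0,1\}^m}(-1)^{|\omega|}f\Big(u+\sum_{i=1}^m\omega_iv_i\Big)=0$$ for all $u,v_1,\dots,v_m\in V$ such that all the points $u+\sum_i\omega_iv_i$, $\omega\in\{0,1\}^m$, lie in $X$. Then there is a function $h:V\to H$ with $h|_X=f$ and $$\sum_{\omega\in\{0,1\}^m}(-1)^{|\omega|}h\Big(u+\sum_{i=1}^m\omega_iv_i\Big)=0\qquad\text{for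 all }u,v_1,\dots,v_m\in V.$$ -/

import Mathlib

namespace UniformExtension

open scoped BigOperators

/-- The number `|ω| = ∑ ωᵢ` for `ω ∈ {0,1}^m`. -/
def weight {m : ℕ} (ω : Fin m → Fin 2) : ℕ := ∑ i, (ω i : ℕ)

/-- The vertex `u + ω · v = u + ∑ ωᵢ vᵢ` of the `m`-cube `(u | v)`. -/
def vertex {V : Type*} [AddCommGroup V] {m : ℕ} (u : V) (v : Fin m → V) (ω : Fin m → Fin 2) : V :=
  u + ∑ i, (ω i : ℕ) • v i

/-- The set `C_m(X)` of `m`-cubes `(u | v)` all of whose vertices lie in `X`. -/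
def cubes {V : Type*} [AddCommGroup V] (m : ℕ) (X : Set V) : Set (V × (Fin m → V)) :=
  {c | ∀ ω : Fin m → Fin 2, vertex c.1 c.2 ω ∈ X}

/-- For `f : X → H`, the function `f_m` on `C_m(X)`,
`f_m(u | v) = ∑_ω (-1)^{|ω|} f(u + ω · v)`. -/
def cubeSumOn {V H : Type*} [AddCommGroup V] [AddCommGroup H] (m : ℕ) {X : Set V} (f : X → H)
    (c : cubes m X) : H :=
  ∑ ω : Fin m → Fin 2, (-1 : ℤ) ^ weight ω • f ⟨vertex c.1.1 c.1.2 ω, c.2 ω⟩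

/-- For `h : V → H`, the function `h_m` on all `m`-cubes of `V`. -/
def cubeSum {V H : Type*} [AddCommGroup V] [AddCommGroup H] (m : ℕ) (h : V → H)
    (u : V) (v : Fin m → V) : H :=
  ∑ ω : Fin m → Fin 2, (-1 : ℤ) ^ weight ω • h (vertex u v ω)

/-- The average `𝔼_{x, v₁, …, v_m} ∏_ω g^ω(x + ω · v)`, where `g^ω` is `g` if `|ω|` is even and
the complex conjugate of `g` otherwise. -/
noncomputable def gowersAverage {V : Type*} [AddCommGroup V] [Fintype V] (m : ℕ) (g : V → ℂ) : ℂ :=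
  𝔼 c : V × (Fin m → V), ∏ ω : Fin m → Fin 2,
    if Even (weight ω) then g (vertex c.1 c.2 ω) else starRingEnd ℂ (g (vertex c.1 c.2 ω))

/-- The Gowers norm `‖g‖_{U_m}`, the `2^m`-th root of the average above. For `m ≥ 1` that average
is a nonnegative real number, so taking its absolute value does not change it. -/
noncomputable def gowersNorm {V : Type*} [AddCommGroup V] [Fintype V] (m : ℕ) (g : V → ℂ) : ℝ :=
  ‖gowersAverage m g‖ ^ ((1 : ℝ) / 2 ^ m)

/-- `X` is `(ε, m)`-uniform if `‖1_X - 𝔼 1_X‖_{U_m} < ε`. -/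
def IsUniform {V : Type*} [AddCommGroup V] [Fintype V] (ε : ℝ) (m : ℕ) (X : Set V) : Prop :=
  gowersNorm m (fun x => X.indicator (1 : V → ℂ) x - 𝔼 y, X.indicator (1 : V → ℂ) y) < ε

/-- The density `|X| / |V|`. -/
noncomputable def density {V : Type*} [Fintype V] (X : Set V) : ℝ :=
  (X.ncard : ℝ) / Fintype.card V

end UniformExtension

namespace UniformExtension

open scoped BigOperators
open Finset

/-! Let `g` be `f` extended by zero. A corner at `x` (a cube whose vertices other than `x` lie in
`X`) predicts a value at `x`, the one making the cube sum vanish: `g x - cubeSum m g x v`, where `g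
x` cancels. Changing one edge of a corner changes the cube sum by that of a cube inside `X`
(`cubeSum_update_eq`), so two corners predict alike once a third edge tuple links both through
hybrid corners. For a pair predicting differently no link exists, whereas a von Neumann type count
(`abs_expect_prod_indicator_sub_le`) finds links for most pairs; hence few pairs disagree
(`expect_inconsistent_mul_le`). Let `h x` be the prediction of a corner agreeing with almost all
others.

Over a cube of `V`, take corners whose edges vary affinely with the vertex. By a union bound some
choice predicts `h` at every vertex; interchanging summations turns the cube sum of `h` into a
combination of cube sums of `g` inside `X` (`cubeSum_eq_zero_of_corners`).

For `δ` near one, `δ ^ C` is not small. The error is therefore measured by `uniformity`, whose `L¹`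
part is small for dense `X`, and one exponent serves all `δ` (`exists_exponent`). -/

lemma vertex_cons_zero {V : Type*} [AddCommGroup V] {m : ℕ} (x a : V) (v : Fin m → V) (ω : Fin m → Fin 2) :
    vertex x (Fin.cons a v : Fin (m + 1) → V) (Fin.cons 0 ω : Fin (m + 1) → Fin 2)
      = vertex x v ω := by
  simp [vertex, Fin.sum_univ_succ]

lemma vertex_cons_one {V : Type*} [AddCommGroup V] {m : ℕ} (x a : V) (v : Fin m → V) (ω : Fin m → Fin 2) :
    vertex x (Fin.cons a v : Fin (m + 1) → V) (Fin.cons 1 ω : Fin (m + 1) → Fin 2)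
      = vertex x v ω + a := by
  simp [vertex, Fin.sum_univ_succ]; abel

/-! ### Gowers averages and the generalised von Neumann inequality. -/

section Averages

variable {V W : Type*} [AddCommGroup V] [Fintype V] [AddCommGroup W] [Fintype W]

lemma expect_comp_add_right (a : W) (φ : W → ℝ) : 𝔼 w, φ (w + a) = 𝔼 w, φ w :=
  Fintype.expect_equiv (Equiv.addRight a) _ _ fun _ => rfl

lemma expect_comp_add_left (a : W) (φ : W → ℝ) : 𝔼 w, φ (a + w) = 𝔼 w, φ w :=
  Fintype.expect_equiv (Equiv.addLeft a) _ _ fun _ => rfl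

/-- A map that some family of translations moves equivariantly is equidistributed. -/
lemma expect_comp_of_equivariant (D : V → W) (y : W → V) (h : ∀ w t, y (w + D t) = y w + t)
    (φ : V → ℝ) : 𝔼 w, φ (y w) = 𝔼 x, φ x := by
  calc 𝔼 w, φ (y w) = 𝔼 t : V, 𝔼 w, φ (y (w + D t)) := by
        simp_rw [fun t => expect_comp_add_right (D t) (fun w => φ (y w))]
        rw [Fintype.expect_const]
    _ = 𝔼 w : W, 𝔼 t, φ (y w + t) := by
        rw [expect_comm]; simp_rw [h]
    _ = 𝔼 x, φ x := by
        simp_rw [fun w => expect_comp_add_left (y w) φ]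
        rw [Fintype.expect_const]

lemma sq_expect_mul_le {α : Type*} [Fintype α] [Nonempty α] (b φ : α → ℝ) (hb : ∀ w, |b w| ≤ 1) :
    (𝔼 w, b w * φ w) ^ 2 ≤ 𝔼 w, φ w ^ 2 := by
  refine (expect_mul_sq_le_sq_mul_sq univ b φ).trans ?_
  have h1 : 𝔼 w, b w ^ 2 ≤ (1 : ℝ) :=
    expect_le univ_nonempty fun w _ => (sq_le_one_iff_abs_le_one _).2 (hb w)
  exact mul_le_of_le_one_left (expect_nonneg fun w _ => sq_nonneg _) h1

lemma expect_pow_two_pow_le {α : Type*} [Fintype α] [Nonempty α] (n : ℕ) (φ : α → ℝ) :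
    (𝔼 w, φ w) ^ 2 ^ n ≤ 𝔼 w, φ w ^ 2 ^ n := by
  induction n generalizing φ with
  | zero => simp
  | succ n ih =>
    have h := sq_expect_mul_le (fun _ => 1) φ (by simp)
    simp only [one_mul] at h
    calc (𝔼 w, φ w) ^ 2 ^ (n + 1) = ((𝔼 w, φ w) ^ 2) ^ 2 ^ n := by rw [← pow_mul, pow_succ']
      _ ≤ (𝔼 w, φ w ^ 2) ^ 2 ^ n := by gcongr
      _ ≤ 𝔼 w, (φ w ^ 2) ^ 2 ^ n := ih _
      _ = _ := by simp_rw [← pow_mul, ← pow_succ']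

/-- The average of a real function over the `m`-cubes of `V`. -/
noncomputable def cubeAverage (m : ℕ) (g : V → ℝ) : ℝ :=
  𝔼 x, 𝔼 v : Fin m → V, ∏ ω : Fin m → Fin 2, g (vertex x v ω)

lemma gowersAverage_ofReal (m : ℕ) (g : V → ℝ) :
    gowersAverage m (fun x => (g x : ℂ)) = cubeAverage m g := by
  unfold gowersAverage cubeAverage
  simp only [Complex.conj_ofReal, ite_self]
  rw [← univ_product_univ, expect_product]
  push_cast
  rfl

lemma cubeAverage_succ (m : ℕ) (g : V → ℝ) :
    cubeAverage (m + 1) g = 𝔼 r, cubeAverage m (fun x => g x * g (x + r)) := by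
  unfold cubeAverage
  beta_reduce
  rw [expect_comm univ univ (fun (r x : V) => 𝔼 v : Fin m → V, ∏ ω : Fin m → Fin 2,
    (g (vertex x v ω) * g (vertex x v ω + r)))]
  refine expect_congr rfl fun x _ => ?_
  rw [← Fintype.expect_equiv (Fin.consEquiv fun _ => V)
    (fun p => ∏ ω : Fin (m + 1) → Fin 2, g (vertex x (Fin.cons p.1 p.2 : Fin (m + 1) → V) ω)) _
    (fun _ => rfl), ← univ_product_univ, expect_product]
  refine expect_congr rfl fun r _ => expect_congr rfl fun v _ => ?_
  rw [← Fintype.prod_equiv (Fin.consEquiv fun _ => Fin 2) (fun p =>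
      g (vertex x (Fin.cons r v : Fin (m + 1) → V) (Fin.cons p.1 p.2 : Fin (m + 1) → Fin 2))) _
    (fun _ => rfl), Fintype.prod_prod_type, Fin.prod_univ_two]
  simp_rw [vertex_cons_zero, vertex_cons_one, prod_mul_distrib]

/-- The generalised von Neumann inequality: weights each of which is insensitive to one of `m`
directions that move `y` freely are invisible to a function of small Gowers norm. -/
lemma expect_mul_prod_pow_le {m : ℕ} (g : V → ℝ) (y : W → V) (D : Fin m → V →+ W)
    (D₀ : V → W) (hy₀ : ∀ w t, y (w + D₀ t) = y w + t)
    (hy : ∀ j w t, y (w + D j t) = y w + t)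
    (b : Fin m → W → ℝ) (hb : ∀ j w, |b j w| ≤ 1) (hbD : ∀ j w t, b j (w + D j t) = b j w) :
    (𝔼 w, g (y w) * ∏ j, b j w) ^ 2 ^ m ≤ cubeAverage m g := by
  induction m generalizing g with
  | zero =>
    simp only [univ_eq_empty, prod_empty, mul_one, pow_zero, pow_one]
    -- `D₀` survives the induction because here none of the directions `D j` is left to
    -- equidistribute `y`.
    rw [expect_comp_of_equivariant D₀ y hy₀]
    simp [cubeAverage, vertex]
  | succ m ih =>
    set β : Fin m → W → ℝ := fun j => b j.succ with hβ
    -- Averaging along `D 0` fixes `b 0`, so Cauchy–Schwarz removes this weight and replaces `g` by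
    -- the products `g x * g (x + r)`.
    have h1 : 𝔼 w, g (y w) * ∏ j, b j w
        = 𝔼 w, b 0 w * 𝔼 t, g (y w + t) * ∏ j, β j (w + D 0 t) := by
      calc 𝔼 w, g (y w) * ∏ j, b j w
          = 𝔼 t : V, 𝔼 w, g (y (w + D 0 t)) * ∏ j, b j (w + D 0 t) := by
            simp_rw [fun t => expect_comp_add_right (D 0 t) (fun w => g (y w) * ∏ j, b j w)]
            rw [Fintype.expect_const]
        _ = _ := by
            rw [expect_comm]
            refine expect_congr rfl fun w _ => ?_
            rw [mul_expect]
            refine expect_congr rfl fun t _ => ?_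
            rw [Fin.prod_univ_succ, hbD, hy]
            ring
    have h2 : 𝔼 w, (𝔼 t, g (y w + t) * ∏ j, β j (w + D 0 t)) ^ 2
        = 𝔼 r, 𝔼 w, (g (y w) * g (y w + r)) * ∏ j, (β j w * β j (w + D 0 r)) := by
      calc 𝔼 w, (𝔼 t, g (y w + t) * ∏ j, β j (w + D 0 t)) ^ 2
          = 𝔼 w, 𝔼 t, 𝔼 r, (g (y w + t) * ∏ j, β j (w + D 0 t)) *
              (g (y w + (t + r)) * ∏ j, β j (w + D 0 (t + r))) := by
            refine expect_congr rfl fun w _ => ?_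
            rw [sq, Fintype.expect_mul_expect]
            refine expect_congr rfl fun t _ => ?_
            exact (expect_comp_add_left t (fun s => (g (y w + t) * ∏ j, β j (w + D 0 t)) *
              (g (y w + s) * ∏ j, β j (w + D 0 s)))).symm
        _ = 𝔼 r, 𝔼 t, 𝔼 w, (g (y (w + D 0 t)) * g (y (w + D 0 t) + r)) *
              ∏ j, (β j (w + D 0 t) * β j (w + D 0 t + D 0 r)) := by
            rw [expect_comm]
            simp_rw [fun t => expect_comm univ univ (fun (w : W) (r : V) =>
              (g (y w + t) * ∏ j, β j (w + D 0 t)) *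
              (g (y w + (t + r)) * ∏ j, β j (w + D 0 (t + r))))]
            rw [expect_comm]
            refine expect_congr rfl fun r _ => expect_congr rfl fun t _ =>
              expect_congr rfl fun w _ => ?_
            rw [prod_mul_distrib, hy, map_add, ← add_assoc, ← add_assoc]
            ring
        _ = _ := by
            refine expect_congr rfl fun r _ => ?_
            simp_rw [fun t => expect_comp_add_right (D 0 t) (fun w =>
              (g (y w) * g (y w + r)) * ∏ j, (β j w * β j (w + D 0 r)))]
            rw [Fintype.expect_const]
    have h3 : ∀ r, (𝔼 w, (g (y w) * g (y w + r)) * ∏ j, (β j w * β j (w + D 0 r))) ^ 2 ^ m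
        ≤ cubeAverage m (fun x => g x * g (x + r)) := fun r => by
      refine ih (fun x => g x * g (x + r)) (fun j => D j.succ) (fun j => hy j.succ)
        (fun j w => β j w * β j (w + D 0 r)) (fun j w => ?_) (fun j w t => ?_)
      · rw [abs_mul]; exact mul_le_one₀ (hb _ _) (abs_nonneg _) (hb _ _)
      · rw [hβ]; simp only [add_right_comm _ _ (D 0 r), hbD]
    calc (𝔼 w, g (y w) * ∏ j, b j w) ^ 2 ^ (m + 1)
        = ((𝔼 w, b 0 w * 𝔼 t, g (y w + t) * ∏ j, β j (w + D 0 t)) ^ 2) ^ 2 ^ m := by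
          rw [h1, ← pow_mul, pow_succ']
      _ ≤ (𝔼 r, 𝔼 w, (g (y w) * g (y w + r)) * ∏ j, (β j w * β j (w + D 0 r))) ^ 2 ^ m := by
          rw [← h2]
          gcongr
          exact sq_expect_mul_le _ _ (hb 0)
      _ ≤ 𝔼 r, (𝔼 w, (g (y w) * g (y w + r)) * ∏ j, (β j w * β j (w + D 0 r))) ^ 2 ^ m :=
          expect_pow_two_pow_le _ _
      _ ≤ 𝔼 r, cubeAverage m (fun x => g x * g (x + r)) := expect_le_expect fun r _ => h3 r
      _ = _ := (cubeAverage_succ m g).symm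

/-- The smaller of the Gowers norm and the `L¹` norm of a real function. -/
noncomputable def uniformity (m : ℕ) (g : V → ℝ) : ℝ :=
  min (|cubeAverage m g| ^ ((1 : ℝ) / 2 ^ m)) (𝔼 x, |g x|)

lemma uniformity_nonneg (m : ℕ) (g : V → ℝ) : 0 ≤ uniformity m g :=
  le_min (by positivity) (expect_nonneg fun _ _ => abs_nonneg _)

lemma abs_expect_mul_prod_le {m : ℕ} (hm : 1 ≤ m) (g : V → ℝ) (y : W → V) (D : Fin m → V →+ W)
    (hy : ∀ j w t, y (w + D j t) = y w + t)
    (b : Fin m → W → ℝ) (hb : ∀ j w, |b j w| ≤ 1) (hbD : ∀ j w t, b j (w + D j t) = b j w) :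
    |𝔼 w, g (y w) * ∏ j, b j w| ≤ uniformity m g := by
  refine le_min ?_ ?_
  · have h := expect_mul_prod_pow_le g y D (D ⟨0, hm⟩) (hy _) hy b hb hbD
    have heven : Even (2 ^ m) := (even_two).pow_of_ne_zero (by omega)
    rw [← heven.pow_abs] at h
    have h' := Real.rpow_le_rpow (by positivity) (h.trans (le_abs_self _))
      (show (0 : ℝ) ≤ 1 / 2 ^ m by positivity)
    rwa [one_div, show ((2 : ℝ) ^ m)⁻¹ = ((2 ^ m : ℕ) : ℝ)⁻¹ by push_cast; rfl,
      Real.pow_rpow_inv_natCast (abs_nonneg _) (by positivity),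
      show (((2 ^ m : ℕ) : ℝ)⁻¹) = 1 / 2 ^ m by push_cast; rw [one_div]] at h'
  · calc |𝔼 w, g (y w) * ∏ j, b j w| ≤ 𝔼 w, |g (y w) * ∏ j, b j w| := abs_expect_le _ _
      _ ≤ 𝔼 w, |g (y w)| := expect_le_expect fun w _ => by
          rw [abs_mul, abs_prod]
          exact mul_le_of_le_one_right (abs_nonneg _)
            (prod_le_one (fun _ _ => abs_nonneg _) fun j _ => hb j w)
      _ = _ := expect_comp_of_equivariant (D ⟨0, hm⟩) y (hy _) fun x => |g x|

end Averages

lemma abs_indicator_le {V : Type*} (X : Set V) (x : V) : |X.indicator (1 : V → ℝ) x| ≤ 1 := by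
  by_cases h : x ∈ X <;> simp [h]

lemma expect_indicator {V : Type*} [Fintype V] (X : Set V) :
    𝔼 x, X.indicator (1 : V → ℝ) x = density X := by
  classical
  rw [density, Fintype.expect_eq_sum_div_card, Set.ncard_eq_toFinset_card']
  simp only [Set.indicator_apply, Pi.one_apply, sum_boole]
  congr 3
  ext x
  simp

/-! ### Counting solutions of systems of linear forms in a uniform set. -/

section Counting

variable {V : Type*} [AddCommGroup V]

/-- The value at `w` of the linear form with integer coefficients `A`. -/
def linearForm {κ : Type*} [Fintype κ] (A : κ → ℤ) (w : κ → V) : V := ∑ k, A k • w k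

/-- The homomorphism `t ↦ (d k • t)ₖ`. -/
def direction {κ : Type*} (d : κ → ℤ) : V →+ (κ → V) where
  toFun t k := d k • t
  map_zero' := by ext; simp
  map_add' _ _ := by ext; simp

lemma linearForm_add_direction {κ : Type*} [Fintype κ] (A d : κ → ℤ) (w : κ → V) (t : V) :
    linearForm A (w + direction d t) = linearForm A w + (A ⬝ᵥ d) • t := by
  simp [linearForm, direction, dotProduct, sum_add_distrib, sum_smul, mul_smul]

/-- Each form of `T` takes the value one on `m` directions, of which every other form kills one
and the weight `Ψ` ignores one. -/
def Separated {ι κ : Type*} [Fintype κ] (m : ℕ) (A : ι → κ → ℤ) (Ψ : (κ → V) → ℝ)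
    (T : Finset ι) : Prop :=
  ∀ i ∈ T, ∃ d : Fin m → κ → ℤ, (∀ j, A i ⬝ᵥ d j = 1) ∧
    (∀ i' ∈ T, i' ≠ i → ∃ j, A i' ⬝ᵥ d j = 0) ∧
    ∃ j, ∀ w t, Ψ (w + direction (d j) t) = Ψ w

variable (X : Set V)

variable [Fintype V]

lemma density_nonneg : 0 ≤ density X := by unfold density; positivity

lemma density_le_one : density X ≤ 1 := by
  rw [← expect_indicator]
  exact expect_le univ_nonempty fun x _ => (le_abs_self _).trans (abs_indicator_le X x)

/-- The function `1_X - 𝔼 1_X`. -/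
noncomputable def balanced (x : V) : ℝ := X.indicator (1 : V → ℝ) x - density X

lemma uniformity_le_of_isUniform {m : ℕ} {ε : ℝ} (h : IsUniform ε m X) :
    uniformity m (balanced X) ≤ ε := by
  refine (min_le_left _ _).trans (le_trans (le_of_eq ?_) h.le)
  have h1 : (fun x => X.indicator (1 : V → ℂ) x - 𝔼 y, X.indicator (1 : V → ℂ) y)
      = fun x => ((balanced X x : ℝ) : ℂ) := by
    have h2 : ∀ x, X.indicator (1 : V → ℂ) x = ((X.indicator (1 : V → ℝ) x : ℝ) : ℂ) := fun x => by
      by_cases hx : x ∈ X <;> simp [hx]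
    funext x
    simp_rw [h2]
    rw [← Complex.ofReal_expect, expect_indicator, balanced, Complex.ofReal_sub]
  rw [h1, gowersNorm, gowersAverage_ofReal, Complex.norm_real, Real.norm_eq_abs]

lemma uniformity_le_two_mul (m : ℕ) : uniformity m (balanced X) ≤ 2 * (1 - density X) := by
  refine (min_le_right _ _).trans ?_
  have h : ∀ x, |balanced X x| ≤ (1 - X.indicator (1 : V → ℝ) x) + (1 - density X) := fun x => by
    have h0 := density_nonneg X
    have h1 := density_le_one X
    rw [balanced, abs_le]
    by_cases hx : x ∈ X <;> simp only [hx, Set.indicator_of_mem, Set.indicator_of_notMem,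
      not_false_eq_true, Pi.one_apply] <;> constructor <;> linarith
  refine (expect_le_expect fun x _ => h x).trans (le_of_eq ?_)
  rw [expect_add_distrib, expect_sub_distrib, expect_indicator, Fintype.expect_const,
    Fintype.expect_const]
  ring

variable {X}

/-- Each remaining indicator is assigned to a direction killing its form, and `Ψ` to one that it
ignores; grouping by direction gives the weights of the von Neumann inequality. -/
lemma abs_expect_balanced_mul_prod_le {ι κ : Type*} [Fintype κ] [DecidableEq κ] [DecidableEq ι] {m : ℕ}
    (hm : 1 ≤ m) (A : ι → κ → ℤ) (c : ι → V) (Ψ : (κ → V) → ℝ) (hΨ : ∀ w, |Ψ w| ≤ 1)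
    {T : Finset ι} {i : ι} (hi : i ∉ T) (hT : Separated m A Ψ (insert i T)) :
    |𝔼 w : κ → V, balanced X (c i + linearForm (A i) w) *
      (Ψ w * ∏ i' ∈ T, X.indicator (1 : V → ℝ) (c i' + linearForm (A i') w))|
        ≤ uniformity m (balanced X) := by
  classical
  obtain ⟨d, hd1, hd0, j₀, hj₀⟩ := hT i (mem_insert_self i T)
  have hex : ∀ i', ∃ j, i' ∈ T → A i' ⬝ᵥ d j = 0 := fun i' => by
    by_cases h : i' ∈ T
    · obtain ⟨j, hj⟩ := hd0 i' (mem_insert_of_mem h) (fun e => hi (e ▸ h))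
      exact ⟨j, fun _ => hj⟩
    · exact ⟨j₀, fun h' => absurd h' h⟩
  choose J hJ using hex
  have key := abs_expect_mul_prod_le hm (balanced X) (fun w : κ → V => c i + linearForm (A i) w)
    (fun j => direction (d j))
    (fun j w t => by simp only [linearForm_add_direction, hd1, one_smul, add_assoc])
    (fun j w => (if j = j₀ then Ψ w else 1) *
      ∏ i' ∈ T with J i' = j, X.indicator (1 : V → ℝ) (c i' + linearForm (A i') w))
    (fun j w => ?_) (fun j w t => ?_)
  · refine le_of_eq_of_le ?_ key
    congr 1
    refine expect_congr rfl fun w _ => ?_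
    rw [prod_mul_distrib, prod_fiberwise]
    simp
  · rw [abs_mul, abs_prod]
    refine mul_le_one₀ ?_ (prod_nonneg fun _ _ => abs_nonneg _)
      (prod_le_one (fun _ _ => abs_nonneg _) fun _ _ => abs_indicator_le _ _)
    split_ifs
    · exact hΨ w
    · simp
  · congr 1
    · split_ifs with h
      · rw [h, hj₀]
      · rfl
    · refine prod_congr rfl fun i' h => ?_
      obtain ⟨h1, rfl⟩ := mem_filter.1 h
      rw [linearForm_add_direction, hJ i' h1, zero_smul, add_zero]

/-- In a uniform set, a separated system of forms has about the expected number of solutions. -/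
lemma abs_expect_prod_indicator_sub_le {ι κ : Type*} [Fintype κ] [DecidableEq κ] {m : ℕ}
    (hm : 1 ≤ m) (A : ι → κ → ℤ) (c : ι → V) (Ψ : (κ → V) → ℝ) (hΨ : ∀ w, |Ψ w| ≤ 1)
    (T : Finset ι) (hT : Separated m A Ψ T) :
    |(𝔼 w : κ → V, Ψ w * ∏ i ∈ T, X.indicator (1 : V → ℝ) (c i + linearForm (A i) w))
        - density X ^ #T * 𝔼 w, Ψ w| ≤ #T * uniformity m (balanced X) := by
  classical
  induction T using Finset.induction_on with
  | empty => simp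
  | insert i T hi ih =>
    have hT' : Separated m A Ψ T := fun i' hi' => by
      obtain ⟨d, h1, h2, h3⟩ := hT i' (mem_insert_of_mem hi')
      exact ⟨d, h1, fun i'' h => h2 i'' (mem_insert_of_mem h), h3⟩
    have e := abs_expect_balanced_mul_prod_le (X := X) hm A c Ψ hΨ hi hT
    have ih := ih hT'
    set P := 𝔼 w : κ → V, Ψ w * ∏ i ∈ T, X.indicator (1 : V → ℝ) (c i + linearForm (A i) w)
      with hP
    -- One indicator at a time is split as balanced part plus density; each split costs one
    -- `uniformity`.
    have hsplit : 𝔼 w : κ → V, Ψ w *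
          ∏ i' ∈ insert i T, X.indicator (1 : V → ℝ) (c i' + linearForm (A i') w)
        = (𝔼 w : κ → V, balanced X (c i + linearForm (A i) w) *
            (Ψ w * ∏ i' ∈ T, X.indicator (1 : V → ℝ) (c i' + linearForm (A i') w)))
          + density X * P := by
      rw [hP, mul_expect, ← expect_add_distrib]
      refine expect_congr rfl fun w _ => ?_
      rw [prod_insert hi, balanced]
      ring
    rw [hsplit, card_insert_of_notMem hi]
    set Q := 𝔼 w : κ → V, balanced X (c i + linearForm (A i) w) *
            (Ψ w * ∏ i' ∈ T, X.indicator (1 : V → ℝ) (c i' + linearForm (A i') w))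
    calc |Q + density X * P - density X ^ (#T + 1) * 𝔼 w, Ψ w|
        = |Q + density X * (P - density X ^ #T * 𝔼 w, Ψ w)| := by congr 1; ring
      _ ≤ |Q| + |density X * (P - density X ^ #T * 𝔼 w, Ψ w)| := abs_add_le _ _
      _ ≤ uniformity m (balanced X) + #T * uniformity m (balanced X) := by
          rw [abs_mul, abs_of_nonneg (density_nonneg X)]
          exact add_le_add e ((mul_le_of_le_one_left (abs_nonneg _) (density_le_one X)).trans ih)
      _ = _ := by push_cast; ring

end Counting

/-- A power of `δ` beats every fixed polynomial loss, once the trivial bound `2 (1 - a)` takes over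
for sets of density close to one. -/
lemma exists_exponent (K L : ℕ) (hK : 1 ≤ K) : ∃ C : ℕ, ∀ δ a : ℝ, 0 < δ → δ < a → a ≤ 1 →
    ∀ θ, θ ≤ δ ^ C → θ ≤ 2 * (1 - a) → K * θ < a ^ L := by
  have hK' : (1 : ℝ) ≤ K := by exact_mod_cast hK
  -- For `a > r`, `(2 * K + L) * (1 - a) < 1`, so Bernoulli gives `2 * K * (1 - a) < a ^ L`. For `a
  -- ≤ r`, the bound `K * r ^ n < 1` absorbs `K`.
  set r : ℝ := 1 - 1 / (2 * K + L + 1) with hr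
  have hpos : (0 : ℝ) < 2 * K + L + 1 := by positivity
  have hr1 : r < 1 := by rw [hr]; linarith [one_div_pos.2 hpos]
  obtain ⟨n, hn⟩ := exists_pow_lt_of_lt_one (show (0 : ℝ) < 1 / K by positivity) hr1
  refine ⟨n + L, fun δ a hδ hδa ha θ h1 h2 => ?_⟩
  rcases le_or_gt a r with har | har
  · have h3 : δ ^ n ≤ r ^ n := pow_le_pow_left₀ hδ.le (hδa.le.trans har) n
    have h4 : K * δ ^ n < 1 := by
      rw [lt_div_iff₀' (by positivity)] at hn
      exact (mul_le_mul_of_nonneg_left h3 (by positivity)).trans_lt hn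
    calc K * θ ≤ K * δ ^ (n + L) := by gcongr
      _ = (K * δ ^ n) * δ ^ L := by ring
      _ < 1 * δ ^ L := by gcongr
      _ ≤ a ^ L := by rw [one_mul]; gcongr
  · have hb : 1 - L * (1 - a) ≤ a ^ L := by
      have := one_add_mul_le_pow (show (-2 : ℝ) ≤ a - 1 by linarith) L
      rw [add_sub_cancel] at this
      linarith
    have h5 : (1 - a) * (2 * K + L + 1) < 1 := by
      rw [← lt_div_iff₀ hpos]; linarith
    have h6 : K * θ ≤ K * (2 * (1 - a)) := by gcongr
    have h7 : 0 ≤ 1 - a := by linarith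
    nlinarith

/-! ### Cube sums of corners under a change of edges. -/

section Cubes

variable {V H : Type*} [AddCommGroup V] [AddCommGroup H] {m : ℕ}

lemma vertex_zero (u : V) (v : Fin m → V) : vertex u v 0 = u := by simp [vertex]

lemma vertex_update (u : V) (v : Fin m → V) (i : Fin m) (b : V) (ω : Fin m → Fin 2) :
    vertex u (Function.update v i b) ω
      = u + ∑ j ∈ univ.erase i, (ω j : ℕ) • v j + (ω i : ℕ) • b := by
  rw [vertex, ← sum_erase_add _ _ (mem_univ i), Function.update_self, add_assoc]
  congr 2
  refine sum_congr rfl fun j hj => ?_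
  rw [Function.update_of_ne (ne_of_mem_erase hj)]

lemma vertex_update_apply_one (u : V) (v : Fin m → V) (i : Fin m) {ω : Fin m → Fin 2}
    (h : ω i = 0) : vertex u v (Function.update ω i 1) = vertex u v ω + v i := by
  rw [vertex, vertex, ← sum_erase_add _ _ (mem_univ i), ← sum_erase_add univ _ (mem_univ i),
    Function.update_self, h, add_assoc]
  congr 1
  simp only [Fin.val_one, one_smul, Fin.val_zero, zero_smul, add_zero, add_left_inj]
  refine sum_congr rfl fun j hj => ?_
  rw [Function.update_of_ne (ne_of_mem_erase hj)]

lemma weight_update_one (i : Fin m) {ω : Fin m → Fin 2} (h : ω i = 0) :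
    weight (Function.update ω i 1) = weight ω + 1 := by
  rw [weight, weight, ← sum_erase_add _ _ (mem_univ i), ← sum_erase_add univ _ (mem_univ i),
    Function.update_self, h]
  simp only [Fin.val_one, Fin.val_zero, add_zero, add_left_inj]
  refine sum_congr rfl fun j hj => ?_
  rw [Function.update_of_ne (ne_of_mem_erase hj)]

lemma cubeSum_eq_sum_face (g : V → H) (u : V) (v : Fin m → V) (i : Fin m) :
    cubeSum m g u v = ∑ ω : Fin m → Fin 2 with ω i = 0,
      (-1 : ℤ) ^ weight ω • (g (vertex u v ω) - g (vertex u v ω + v i)) := by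
  rw [cubeSum, ← sum_filter_add_sum_filter_not univ (fun ω : Fin m → Fin 2 => ω i = 0)]
  simp_rw [smul_sub, sum_sub_distrib, sub_eq_add_neg]
  congr 1
  rw [← sum_neg_distrib]
  symm
  refine sum_bij' (fun ω _ => Function.update ω i 1) (fun ω _ => Function.update ω i 0)
    (by simp) (by simp) ?_ ?_ ?_
  · intro ω hω
    rw [mem_filter] at hω
    simp [← hω.2]
  · intro ω hω
    rw [mem_filter] at hω
    have : ω i = 1 := by omega
    simp [← this]
  · intro ω hω
    rw [mem_filter] at hω
    rw [weight_update_one i hω.2, vertex_update_apply_one u v i hω.2, pow_succ]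
    simp

/-- All vertices of the cube `(x | v)` other than `x` lie in `X`. -/
def IsCorner (X : Set V) (x : V) (v : Fin m → V) : Prop :=
  ∀ ω : Fin m → Fin 2, ω ≠ 0 → vertex x v ω ∈ X

variable {X : Set V} {g : V → H}

/-- The vertices with `ω i = 0` are common and cancel. Those with `ω i = 1` form the cube at `x + v
i` with `i`-th edge `a - v i`, which avoids the zero vertex of either corner and so lies in `X`. -/
lemma cubeSum_update_eq (hg : ∀ u (v : Fin m → V), (∀ ω, vertex u v ω ∈ X) → cubeSum m g u v = 0)
    {x : V} {v : Fin m → V} {i : Fin m} {a : V} (hv : IsCorner X x v)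
    (hv' : IsCorner X x (Function.update v i a)) :
    cubeSum m g x (Function.update v i a) = cubeSum m g x v := by
  have h0 : ∀ (y b : V) (ω : Fin m → Fin 2), ω i = 0 →
      vertex y (Function.update v i b) ω = vertex y v ω := fun y b ω h => by
    conv_rhs => rw [← Function.update_eq_self i v]
    rw [vertex_update, vertex_update, h]
    simp
  have hshift : ∀ (y b : V) (ω : Fin m → Fin 2), vertex (y + b) v ω = vertex y v ω + b :=
    fun y b ω => by rw [vertex, vertex]; abel
  have hz := hg (x + v i) (Function.update v i (a - v i)) fun ω => by
    by_cases h : ω i = 0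
    · rw [h0 _ _ _ h, hshift, ← vertex_update_apply_one x v i h]
      refine hv _ fun e => ?_
      simpa using congrFun e i
    · have h1 : ω i = 1 := by omega
      have := hv' ω (fun e => h (congrFun e i))
      rw [vertex_update, h1] at this ⊢
      convert this using 1
      simp only [Fin.val_one, one_smul]
      abel
  rw [cubeSum_eq_sum_face g _ _ i] at hz
  rw [← sub_eq_zero, cubeSum_eq_sum_face g x _ i, cubeSum_eq_sum_face g x v i, ← sum_sub_distrib,
    ← hz]
  refine sum_congr rfl fun ω hω => ?_
  have h := (mem_filter.1 hω).2
  rw [← smul_sub, h0 _ _ _ h, h0 _ _ _ h, hshift, Function.update_self, Function.update_self]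
  congr 1
  rw [add_assoc, add_sub_cancel]
  abel

lemma cubeSum_eq_of_isCorner_piecewise
    (hg : ∀ u (v : Fin m → V), (∀ ω, vertex u v ω ∈ X) → cubeSum m g u v = 0)
    {x : V} {u v : Fin m → V} (h : ∀ s : Finset (Fin m), IsCorner X x (s.piecewise u v)) :
    cubeSum m g x u = cubeSum m g x v := by
  have key : ∀ s : Finset (Fin m), cubeSum m g x (s.piecewise u v) = cubeSum m g x v := fun s => by
    induction s using Finset.induction_on with
    | empty => rw [piecewise_empty]
    | insert i s _ ih =>
      have h1 := h (insert i s)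
      rw [piecewise_insert] at h1 ⊢
      exact (cubeSum_update_eq hg (h s) h1).trans ih
  simpa using key univ

end Cubes

/-! ### Most pairs of corners at a point agree. -/

section Corners

variable {V H : Type*} [AddCommGroup V] [AddCommGroup H] {m : ℕ}

/-- The form adding up, over the `j` with `c j = some s`, the variables with index `(s, j)`. -/
def symbolForm (c : Fin m → Option (Fin 3)) (p : Fin 3 × Fin m) : ℤ :=
  if c p.2 = some p.1 then 1 else 0

/-- The symbol at `j` says from which of three edge tuples the `j`-th edge is taken, `none` omitting
it; the forms thus run through the vertices of all hybrid cubes. -/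
lemma linearForm_symbolForm (x : V) (σ : Fin m → Fin 3) (ω : Fin m → Fin 2)
    (z : Fin 3 × Fin m → V) :
    x + linearForm (symbolForm fun j => if ω j = 0 then none else some (σ j)) z
      = vertex x (fun j => z (σ j, j)) ω := by
  rw [vertex, linearForm, Fintype.sum_prod_type_right]
  congr 1
  refine sum_congr rfl fun j _ => ?_
  rcases (show ω j = 0 ∨ ω j = 1 by omega) with h | h
  · simp [symbolForm, h]
  · simp [symbolForm, h, eq_comm]

/-- The directions separating `c` from the other symbol forms, where `c i = some 2`. -/
def symbolDirection (c : Fin m → Option (Fin 3)) (i j : Fin m) : Fin 3 × Fin m → ℤ :=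
  match c j with
  | some s => Pi.single (s, j) 1
  | none => Pi.single (2, i) 1 - fun p => if p.2 = j then 1 else 0

lemma symbolForm_dotProduct (c c' : Fin m → Option (Fin 3)) (i j : Fin m) :
    symbolForm c' ⬝ᵥ symbolDirection c i j = match c j with
      | some s => if c' j = some s then 1 else 0
      | none => (if c' i = some 2 then 1 else 0) - if c' j = none then 0 else 1 := by
  unfold symbolDirection
  cases hc : c j with
  | some s => simp [symbolForm]
  | none =>
    simp only [dotProduct_sub, dotProduct_single, symbolForm, mul_one]
    congr 1
    rw [dotProduct, Fintype.sum_prod_type]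
    cases hc' : c' j with
    | none => simp [symbolForm, hc']
    | some s => simp [symbolForm, hc']

/-- If no direction kills `c'`, then `c'` agrees with `c` wherever `c` is not `none`, in particular
at `i`; the directions with `c j = none` then force `c' j = none`. The direction indexed by `i`
moves only the third tuple, which `Ψ` ignores. -/
lemma separated_symbolForm (Ψ : (Fin 3 × Fin m → V) → ℝ)
    (hΨ : ∀ i w (t : V), Ψ (w + direction (Pi.single (2, i) 1) t) = Ψ w) :
    Separated m symbolForm Ψ {c : Fin m → Option (Fin 3) | ∃ j, c j = some 2} := by
  intro c hc
  obtain ⟨i, hi⟩ := (mem_filter.1 hc).2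
  refine ⟨symbolDirection c i, fun j => ?_, fun c' hc' hne => ?_, i, ?_⟩
  · rw [symbolForm_dotProduct]
    cases hj : c j <;> simp [hi]
  · by_contra! hcon
    simp_rw [symbolForm_dotProduct] at hcon
    have hs : ∀ j s, c j = some s → c' j = some s := fun j s hj => by
      have := hcon j
      rw [hj] at this
      simpa using this
    refine hne (funext fun j => ?_)
    cases hj : c j with
    | some s => exact hs j s hj
    | none =>
      have := hcon j
      rw [hj] at this
      by_contra hj'
      simp [hs i 2 hi, hj'] at this
  · unfold symbolDirection
    rw [hi]
    exact hΨ i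

variable {X : Set V} {g : V → H}

lemma isCorner_of_symbolForm {x : V} {z : Fin 3 × Fin m → V} {a : Fin 3}
    (ha : IsCorner X x fun j => z (a, j))
    (hz : ∀ c : Fin m → Option (Fin 3), (∃ j, c j = some 2) → x + linearForm (symbolForm c) z ∈ X)
    (s : Finset (Fin m)) :
    IsCorner X x (s.piecewise (fun j => z (2, j)) (fun j => z (a, j))) := by
  intro ω hω
  have hp : s.piecewise (fun j => z (2, j)) (fun j => z (a, j))
      = fun j => z (s.piecewise (fun _ => 2) (fun _ => a) j, j) := by
    funext j
    by_cases h : j ∈ s <;> simp [h]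
  by_cases h : ∃ j ∈ s, ω j ≠ 0
  · obtain ⟨j, hj, hj'⟩ := h
    rw [hp, ← linearForm_symbolForm]
    exact hz _ ⟨j, by simp [hj, hj']⟩
  · push Not at h
    have : vertex x (s.piecewise (fun j => z (2, j)) (fun j => z (a, j))) ω
        = vertex x (fun j => z (a, j)) ω := by
      rw [vertex, vertex]
      congr 1
      refine sum_congr rfl fun j _ => ?_
      by_cases hj : j ∈ s <;> simp [hj, h]
    rw [this]
    exact ha ω hω

variable [Fintype V]

open Classical in
/-- Almost all pairs of corners at `x` give the same value of `g` at `x`. -/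
lemma expect_inconsistent_mul_le (hm : 1 ≤ m)
    (hg : ∀ u (v : Fin m → V), (∀ ω, vertex u v ω ∈ X) → cubeSum m g u v = 0) (x : V) :
    (𝔼 p : (Fin m → V) × (Fin m → V), if IsCorner X x p.1 ∧ IsCorner X x p.2 ∧
        cubeSum m g x p.2 ≠ cubeSum m g x p.1 then (1 : ℝ) else 0) * density X ^ 4 ^ m
      ≤ 4 ^ m * uniformity m (balanced X) := by
  set φ : (Fin m → V) × (Fin m → V) → ℝ := fun p => if IsCorner X x p.1 ∧ IsCorner X x p.2 ∧
        cubeSum m g x p.2 ≠ cubeSum m g x p.1 then (1 : ℝ) else 0 with hφ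
  have hφ0 : ∀ p, 0 ≤ φ p := fun p => by simp only [hφ]; split_ifs <;> simp
  set y : (Fin 3 × Fin m → V) → (Fin m → V) × (Fin m → V) :=
    fun z => (fun j => z (0, j), fun j => z (1, j)) with hy
  have hexp : 𝔼 z, φ (y z) = 𝔼 p, φ p :=
    expect_comp_of_equivariant (fun p q => ![p.1 q.2, p.2 q.2, 0] q.1) y
      (fun w t => by ext j <;> simp [hy]) φ
  set T : Finset (Fin m → Option (Fin 3)) := {c | ∃ j, c j = some 2} with hT
  have hcard : #T ≤ 4 ^ m := (card_le_univ T).trans (by simp)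
  have hcount := abs_expect_prod_indicator_sub_le (X := X) hm symbolForm (fun _ => x)
    (fun z => φ (y z)) (fun z => by simp only [hφ]; split_ifs <;> simp) T
    (separated_symbolForm _ fun i w t => by
      congr 1
      ext j <;> simp [hy, direction])
  -- If all vertices using the third tuple lie in `X`, it links both corners, so they cannot
  -- disagree.
  have hzero : 𝔼 z, φ (y z) * ∏ c ∈ T, X.indicator (1 : V → ℝ) (x + linearForm (symbolForm c) z)
      = 0 := by
    refine expect_eq_zero fun z _ => ?_
    by_contra hne
    obtain ⟨h1, h2⟩ := mul_ne_zero_iff.1 hne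
    have h3 : ∀ c : Fin m → Option (Fin 3), (∃ j, c j = some 2) →
        x + linearForm (symbolForm c) z ∈ X := fun c hc => by
      have := prod_ne_zero_iff.1 h2 c (by simp [hT, hc])
      exact Set.mem_of_indicator_ne_zero this
    simp only [hφ, ne_eq, ite_eq_right_iff, one_ne_zero, imp_false, not_not] at h1
    obtain ⟨hc0, hc1, hne⟩ := h1
    exact hne ((cubeSum_eq_of_isCorner_piecewise hg (isCorner_of_symbolForm hc1 h3)).symm.trans
      (cubeSum_eq_of_isCorner_piecewise hg (isCorner_of_symbolForm hc0 h3)))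
  rw [hzero, hexp, zero_sub, abs_neg, abs_of_nonneg (mul_nonneg (pow_nonneg (density_nonneg X) _)
    (expect_nonneg fun p _ => hφ0 p)), mul_comm] at hcount
  calc (𝔼 p, φ p) * density X ^ 4 ^ m ≤ (𝔼 p, φ p) * density X ^ #T :=
        mul_le_mul_of_nonneg_left (pow_le_pow_of_le_one (density_nonneg X) (density_le_one X) hcard)
          (expect_nonneg fun p _ => hφ0 p)
    _ ≤ #T * uniformity m (balanced X) := hcount
    _ ≤ 4 ^ m * uniformity m (balanced X) := by
        gcongr
        · exact uniformity_nonneg _ _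
        · exact_mod_cast hcard

end Corners

/-! ### Cubes of corners with affinely varying edges, and the extension. -/

section CubesOfCorners

variable {V : Type*} [AddCommGroup V] {m : ℕ}

/-- The tuple of edges depending affinely on `ω ∈ {0,1}^m`, with coefficients `w`. -/
def affineEdges (w : Fin m × Option (Fin m) → V) (ω : Fin m → Fin 2) (i : Fin m) : V :=
  vertex (w (i, none)) (fun j => w (i, some j)) ω

/-- The coefficient of a variable of `affineEdges` in the vertex `q.2` of the corner at `q.1`. -/
def cornerForm (q : (Fin m → Fin 2) × (Fin m → Fin 2)) (p : Fin m × Option (Fin m)) : ℤ :=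
  (q.2 p.1 : ℕ) * p.2.elim 1 fun j => ((q.1 j : ℕ) : ℤ)

lemma add_linearForm_cornerForm (x : V) (q : (Fin m → Fin 2) × (Fin m → Fin 2))
    (w : Fin m × Option (Fin m) → V) :
    x + linearForm (cornerForm q) w = vertex x (affineEdges w q.1) q.2 := by
  rw [linearForm, vertex, Fintype.sum_prod_type]
  congr 1
  refine sum_congr rfl fun i _ => ?_
  simp only [Fintype.sum_option, cornerForm, affineEdges, vertex, Option.elim, mul_smul,
    smul_add, smul_sum, one_smul, natCast_zsmul]

/-- The coordinate at `j` if `ω j = 1`, and the difference of those at `i` and `j` otherwise. -/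
def edgeFactor (ω : Fin m → Fin 2) (i j : Fin m) : Fin m → ℤ :=
  if ω j = 0 then Pi.single i 1 - Pi.single j 1 else Pi.single j 1

/-- The affine function of `ω'` which is `1` if `ω' j = ω j` and `0` otherwise. -/
def baseFactor (ω : Fin m → Fin 2) (j : Fin m) : Option (Fin m) → ℤ
  | none => if ω j = 0 then 1 else 0
  | some k => if k = j then (if ω j = 0 then -1 else 1) else 0

lemma sum_mul_edgeFactor (ω ω' : Fin m → Fin 2) (i j : Fin m) :
    ∑ k, ((ω' k : ℕ) : ℤ) * edgeFactor ω i j k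
      = if ω j = 0 then ((ω' i : ℕ) : ℤ) - (ω' j : ℕ) else (ω' j : ℕ) := by
  unfold edgeFactor
  split_ifs <;> simp [mul_sub, sum_sub_distrib, Pi.single_apply]

lemma sum_mul_baseFactor (ω ω' : Fin m → Fin 2) (j : Fin m) :
    ∑ o : Option (Fin m), (o.elim 1 fun k => ((ω' k : ℕ) : ℤ)) * baseFactor ω j o
      = if ω' j = ω j then 1 else 0 := by
  rw [Fintype.sum_option]
  simp only [baseFactor, Option.elim, mul_ite, mul_zero, sum_ite_eq', mem_univ, if_true]
  rcases (show ω j = 0 ∨ ω j = 1 by omega) with h | h <;>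
    rcases (show ω' j = 0 ∨ ω' j = 1 by omega) with h' | h' <;> simp [h, h']

lemma cornerForm_dotProduct (q q' : (Fin m → Fin 2) × (Fin m → Fin 2)) (i j : Fin m) :
    (cornerForm q' ⬝ᵥ fun p => edgeFactor q.2 i j p.1 * baseFactor q.1 j p.2)
      = (if q.2 j = 0 then ((q'.2 i : ℕ) : ℤ) - (q'.2 j : ℕ) else (q'.2 j : ℕ)) *
        if q'.1 j = q.1 j then 1 else 0 := by
  rw [← sum_mul_edgeFactor, ← sum_mul_baseFactor, sum_mul_sum, dotProduct, Fintype.sum_prod_type]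
  refine sum_congr rfl fun k _ => sum_congr rfl fun o _ => ?_
  rw [cornerForm]
  ring

/-- The pairing is a product. If it never vanishes, the base factors force `q'.1 = q.1`, and the
edge factors force `q'.2` to be `1` where `q.2` is, hence at `i`, and then `0` where `q.2` is `0`.
Forms with `q.2 = 0` vanish identically and must be excluded. -/
lemma separated_cornerForm (hm : 1 ≤ m) :
    Separated m cornerForm (fun _ : Fin m × Option (Fin m) → V => 1)
      {q : (Fin m → Fin 2) × (Fin m → Fin 2) | q.2 ≠ 0} := by
  intro q hq
  obtain ⟨i, hi⟩ := Function.ne_iff.1 (mem_filter.1 hq).2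
  have hi1 : q.2 i = 1 := by
    rw [Pi.zero_apply] at hi
    omega
  refine ⟨fun j p => edgeFactor q.2 i j p.1 * baseFactor q.1 j p.2, fun j => ?_,
    fun q' hq' hne => ?_, ⟨0, hm⟩, fun _ _ => rfl⟩
  · rw [cornerForm_dotProduct]
    rcases (show q.2 j = 0 ∨ q.2 j = 1 by omega) with h | h <;> simp [h, hi1]
  · by_contra! hcon
    simp_rw [cornerForm_dotProduct] at hcon
    have h1 : q'.1 = q.1 := funext fun j => by
      by_contra h
      exact hcon j (by simp [h])
    have hs : ∀ j, q.2 j = 1 → q'.2 j = 1 := fun j hj => by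
      have := hcon j
      rw [hj] at this
      by_contra h
      have h0 : q'.2 j = 0 := by omega
      simp [h0] at this
    refine hne (Prod.ext h1 (funext fun j => ?_))
    rcases (show q.2 j = 0 ∨ q.2 j = 1 by omega) with h | h
    · rw [h]
      have := hcon j
      by_contra hj
      have hj1 : q'.2 j = 1 := by omega
      simp [h, hs i hi1, hj1] at this
    · rw [h, hs j h]

lemma affineEdges_add (w : Fin m × Option (Fin m) → V) (v : Fin m → V) (ω : Fin m → Fin 2) :
    affineEdges (w + fun p => p.2.elim (v p.1) fun _ => 0) ω = affineEdges w ω + v := by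
  funext i
  simp [affineEdges, vertex]
  abel

/-- The point is affine in `ω` for fixed `ω'` as well, so the family of corners can be resliced into
cubes indexed by `ω'`. -/
lemma vertex_affineEdges (u : V) (v : Fin m → V) (w : Fin m × Option (Fin m) → V)
    (ω ω' : Fin m → Fin 2) :
    vertex (vertex u v ω) (affineEdges w ω) ω'
      = vertex (vertex u (fun i => w (i, none)) ω')
          (fun j => vertex (v j) (fun i => w (i, some j)) ω') ω := by
  simp only [vertex, affineEdges, smul_add, sum_add_distrib, smul_sum]
  rw [sum_comm (f := fun i j => (ω' i : ℕ) • (ω j : ℕ) • w (i, some j))]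
  simp_rw [fun i j => smul_comm (ω' i : ℕ) (ω j : ℕ) (w (i, some j))]
  abel

variable {H : Type*} [AddCommGroup H] {X : Set V} {g : V → H}

/-- Cube sums vanish for a function which agrees, on the vertices of the cube, with its values
predicted from corners in `X` whose edges vary affinely. -/
lemma cubeSum_eq_zero_of_corners
    (hg : ∀ u (v : Fin m → V), (∀ ω, vertex u v ω ∈ X) → cubeSum m g u v = 0) {h : V → H}
    {u : V} {v : Fin m → V} (w : Fin m × Option (Fin m) → V)
    (hw : ∀ ω, IsCorner X (vertex u v ω) (affineEdges w ω))
    (hh : ∀ ω, h (vertex u v ω)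
      = g (vertex u v ω) - cubeSum m g (vertex u v ω) (affineEdges w ω)) :
    cubeSum m h u v = 0 := by
  have h1 : ∀ ω, h (vertex u v ω) = -∑ ω' ∈ univ.erase 0,
      (-1 : ℤ) ^ weight ω' • g (vertex (vertex u v ω) (affineEdges w ω) ω') := fun ω => by
    rw [hh, cubeSum, ← sum_erase_add _ _ (mem_univ 0), vertex_zero]
    simp [weight]
  rw [cubeSum]
  simp_rw [h1, smul_neg, smul_sum]
  rw [sum_neg_distrib, neg_eq_zero, sum_comm]
  refine sum_eq_zero fun ω' hω' => ?_
  have := hg (vertex u (fun i => w (i, none)) ω')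
    (fun j => vertex (v j) (fun i => w (i, some j)) ω') fun ω => by
      rw [← vertex_affineEdges]
      exact hw ω ω' (ne_of_mem_erase hω')
  rw [cubeSum] at this
  rw [sum_congr rfl fun ω _ => smul_comm ((-1 : ℤ) ^ weight ω) ((-1 : ℤ) ^ weight ω') _,
    ← smul_sum]
  simp_rw [vertex_affineEdges, this, smul_zero]

variable [Fintype V]

open Classical in
lemma le_expect_forall_isCorner (hm : 1 ≤ m) (X : Set V) (u : V) (v : Fin m → V) :
    density X ^ 4 ^ m - 4 ^ m * uniformity m (balanced X)
      ≤ 𝔼 w : Fin m × Option (Fin m) → V,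
        if ∀ ω, IsCorner X (vertex u v ω) (affineEdges w ω) then (1 : ℝ) else 0 := by
  set T : Finset ((Fin m → Fin 2) × (Fin m → Fin 2)) := {q | q.2 ≠ 0} with hT
  have hcard : #T ≤ 4 ^ m := (card_le_univ T).trans (by simp [← mul_pow])
  have h := abs_expect_prod_indicator_sub_le (X := X) hm cornerForm (fun q => vertex u v q.1)
    (fun _ => 1) (by simp) T (separated_cornerForm hm)
  simp only [one_mul, Fintype.expect_const, mul_one, add_linearForm_cornerForm] at h
  have h1 : density X ^ 4 ^ m ≤ density X ^ #T :=
    pow_le_pow_of_le_one (density_nonneg X) (density_le_one X) hcard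
  have h2 : #T * uniformity m (balanced X) ≤ 4 ^ m * uniformity m (balanced X) := by
    gcongr
    · exact uniformity_nonneg _ _
    · exact_mod_cast hcard
  have h3 : 𝔼 w : Fin m × Option (Fin m) → V, ∏ q ∈ T,
        X.indicator (1 : V → ℝ) (vertex (vertex u v q.1) (affineEdges w q.1) q.2)
      ≤ 𝔼 w : Fin m × Option (Fin m) → V,
        if ∀ ω, IsCorner X (vertex u v ω) (affineEdges w ω) then (1 : ℝ) else 0 := by
    refine expect_le_expect fun w _ => ?_
    split_ifs with hw
    · exact prod_le_one (fun _ _ => Set.indicator_nonneg (by simp) _) fun _ _ =>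
        (le_abs_self _).trans (abs_indicator_le X _)
    · simp only [IsCorner, not_forall] at hw
      obtain ⟨ω, ω', hω', hx⟩ := hw
      exact (prod_eq_zero (i := (ω, ω')) (by simp [hT, hω']) (by simp [hx])).le
  have h4 := (abs_le.1 h).1
  linarith

lemma expect_affineEdges (φ : (Fin m → V) → ℝ) (ω : Fin m → Fin 2) :
    𝔼 w : Fin m × Option (Fin m) → V, φ (affineEdges w ω) = 𝔼 v, φ v :=
  expect_comp_of_equivariant (fun v p => p.2.elim (v p.1) fun _ => 0) (fun w => affineEdges w ω)
    (fun w v => affineEdges_add w v ω) φ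

open Classical in
lemma le_expect_isCorner (hm : 1 ≤ m) (X : Set V) (x : V) :
    density X ^ 4 ^ m - 4 ^ m * uniformity m (balanced X)
      ≤ 𝔼 v : Fin m → V, if IsCorner X x v then (1 : ℝ) else 0 := by
  -- The degenerate cube with all edges zero has only the vertex `x`.
  refine (le_expect_forall_isCorner hm X x 0).trans ?_
  rw [← expect_affineEdges _ 0]
  refine expect_le_expect fun w _ => ?_
  by_cases h : IsCorner X x (affineEdges w 0)
  · simp only [h, if_true]
    split_ifs <;> simp
  · rw [if_neg fun h' => h (by simpa [vertex_zero] using h' 0)]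
    simp [h]

open Classical in
/-- Some corner at `x` predicts the same value as almost all others. -/
lemma exists_isCorner_expect_mul_le (hm : 1 ≤ m)
    (hg : ∀ u (v : Fin m → V), (∀ ω, vertex u v ω ∈ X) → cubeSum m g u v = 0) (x : V)
    (hpos : 0 < 𝔼 v : Fin m → V, if IsCorner X x v then (1 : ℝ) else 0) :
    ∃ v, IsCorner X x v ∧
      (𝔼 w, if IsCorner X x w ∧ cubeSum m g x w ≠ cubeSum m g x v then (1 : ℝ) else 0) *
        (𝔼 v : Fin m → V, if IsCorner X x v then (1 : ℝ) else 0) * density X ^ 4 ^ m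
        ≤ 4 ^ m * uniformity m (balanced X) := by
  have hbad := expect_inconsistent_mul_le hm hg x
  set G := 𝔼 v : Fin m → V, if IsCorner X x v then (1 : ℝ) else 0 with hG
  set N : (Fin m → V) → ℝ := fun v =>
    𝔼 w, if IsCorner X x w ∧ cubeSum m g x w ≠ cubeSum m g x v then (1 : ℝ) else 0 with hN
  have hpair : (𝔼 p : (Fin m → V) × (Fin m → V), if IsCorner X x p.1 ∧ IsCorner X x p.2 ∧
        cubeSum m g x p.2 ≠ cubeSum m g x p.1 then (1 : ℝ) else 0)
      = 𝔼 v, (if IsCorner X x v then (1 : ℝ) else 0) * N v := by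
    rw [← univ_product_univ, expect_product]
    refine expect_congr rfl fun v _ => ?_
    rw [hN, mul_expect]
    refine expect_congr rfl fun w _ => ?_
    by_cases h : IsCorner X x v <;> simp [h]
  have hlt : ∃ v, IsCorner X x v ∧
      N v * G ≤ 𝔼 v, (if IsCorner X x v then (1 : ℝ) else 0) * N v := by
    -- Otherwise averaging `B < N v * G` over the corners `v` gives `G * B < B * G`.
    by_contra! hcon
    set B := 𝔼 v, (if IsCorner X x v then (1 : ℝ) else 0) * N v with hB
    have : 𝔼 v : Fin m → V, (if IsCorner X x v then (1 : ℝ) else 0) * B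
        < 𝔼 v, (if IsCorner X x v then (1 : ℝ) else 0) * (N v * G) := by
      refine expect_lt_expect (fun v _ => ?_) ?_
      · by_cases h : IsCorner X x v
        · simpa [h] using (hcon v h).le
        · simp [h]
      · obtain ⟨v, -, hv⟩ := exists_ne_zero_of_expect_ne_zero hpos.ne'
        have h : IsCorner X x v := by
          by_contra h
          simp [h] at hv
        exact ⟨v, mem_univ v, by simpa [h] using hcon v h⟩
    simp_rw [← mul_assoc] at this
    rw [← expect_mul, ← expect_mul, ← hG, ← hB, mul_comm] at this
    exact lt_irrefl _ this
  obtain ⟨v, hv, hle⟩ := hlt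
  refine ⟨v, hv, (mul_le_mul_of_nonneg_right hle (pow_nonneg (density_nonneg X) _)).trans ?_⟩
  rwa [← hpair]

/-- Extension from a set whose balanced indicator has small Gowers norm, relative to its density. -/
lemma exists_extension (hm : 1 ≤ m)
    (hg : ∀ u (v : Fin m → V), (∀ ω, vertex u v ω ∈ X) → cubeSum m g u v = 0)
    (hX : 4 * 8 ^ m * uniformity m (balanced X) < density X ^ (3 * 4 ^ m)) :
    ∃ h : V → H, (∀ u (v : Fin m → V), cubeSum m h u v = 0) ∧ ∀ x ∈ X, h x = g x := by
  classical
  set θ := uniformity m (balanced X) with hθ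
  have hθ0 : 0 ≤ θ := uniformity_nonneg _ _
  set p := density X ^ 4 ^ m with hp
  have hp3 : 4 * 8 ^ m * θ < p ^ 3 := by rwa [hp, ← pow_mul, mul_comm (4 ^ m)]
  have hp0 : 0 ≤ p := pow_nonneg (density_nonneg X) _
  have hp1 : p ≤ 1 := pow_le_one₀ (density_nonneg X) (density_le_one X)
  have hppos : 0 < p := by
    refine lt_of_le_of_ne hp0 fun e => ?_
    rw [← e] at hp3
    have : 0 ≤ 4 * 8 ^ m * θ := by positivity
    norm_num at hp3
    linarith
  have h48 : (4 : ℝ) ^ m * θ ≤ 8 ^ m * θ := by gcongr; norm_num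
  have hρ : p / 2 ≤ p - 4 ^ m * θ := by
    have : p ^ 3 ≤ p := by
      simpa using pow_le_pow_of_le_one hp0 hp1 (show 1 ≤ 3 by norm_num)
    linarith
  have hG : ∀ x, p / 2 ≤ 𝔼 v : Fin m → V, if IsCorner X x v then (1 : ℝ) else 0 :=
    fun x => hρ.trans (le_expect_isCorner hm X x)
  choose c hc hN using fun x => exists_isCorner_expect_mul_le hm hg x
    ((half_pos hppos).trans_le (hG x))
  set N : V → ℝ := fun x =>
    𝔼 w, if IsCorner X x w ∧ cubeSum m g x w ≠ cubeSum m g x (c x) then (1 : ℝ) else 0 with hNdef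
  -- The union bound over `2 ^ m` vertices turns `4 ^ m` into `8 ^ m`; the two factors `p / 2` and
  -- one `p` account for `4` and `p ^ 3` in `hX`.
  have hNlt : ∀ x, 2 ^ m * N x < p / 2 := fun x => by
    have hN0 : 0 ≤ N x := expect_nonneg fun w _ => by split_ifs <;> simp
    have h1 : N x * (p / 2) * p ≤ 4 ^ m * θ :=
      (mul_le_mul_of_nonneg_right (mul_le_mul_of_nonneg_left (hG x) hN0) hp0).trans (hN x)
    have h2 : 2 ^ m * (N x * (p / 2) * p) ≤ 8 ^ m * θ := by
      calc 2 ^ m * (N x * (p / 2) * p) ≤ 2 ^ m * (4 ^ m * θ) := by gcongr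
        _ = 8 ^ m * θ := by rw [← mul_assoc, ← mul_pow]; norm_num
    have h3 : (2 ^ m * N x) * (p ^ 2 / 2) < (p / 2) * (p ^ 2 / 2) := by
      calc (2 ^ m * N x) * (p ^ 2 / 2) = 2 ^ m * (N x * (p / 2) * p) := by ring
        _ ≤ 8 ^ m * θ := h2
        _ < (p / 2) * (p ^ 2 / 2) := by linarith
    exact lt_of_mul_lt_mul_right h3 (by positivity)
  refine ⟨fun x => g x - cubeSum m g x (c x), fun u v => ?_, fun x hx => ?_⟩
  · have hex : ∃ w : Fin m × Option (Fin m) → V, ∀ ω,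
        IsCorner X (vertex u v ω) (affineEdges w ω) ∧
        cubeSum m g (vertex u v ω) (affineEdges w ω)
          = cubeSum m g (vertex u v ω) (c (vertex u v ω)) := by
      by_contra! hcon
      -- Each `affineEdges w ω` is equidistributed, so the failure probability at a vertex is
      -- exactly `N` there.
      have hle : p / 2 ≤ ∑ ω, N (vertex u v ω) := by
        calc p / 2 ≤ 𝔼 w : Fin m × Option (Fin m) → V,
              if ∀ ω, IsCorner X (vertex u v ω) (affineEdges w ω) then (1 : ℝ) else 0 :=
              hρ.trans (le_expect_forall_isCorner hm X u v)
          _ ≤ 𝔼 w : Fin m × Option (Fin m) → V, ∑ ω,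
              if IsCorner X (vertex u v ω) (affineEdges w ω) ∧
                cubeSum m g (vertex u v ω) (affineEdges w ω)
                  ≠ cubeSum m g (vertex u v ω) (c (vertex u v ω)) then (1 : ℝ) else 0 := by
              refine expect_le_expect fun w _ => ?_
              have hnn : ∀ ω ∈ univ, (0 : ℝ) ≤
                  if IsCorner X (vertex u v ω) (affineEdges w ω) ∧
                    cubeSum m g (vertex u v ω) (affineEdges w ω)
                    ≠ cubeSum m g (vertex u v ω) (c (vertex u v ω)) then (1 : ℝ) else 0 :=
                fun ω _ => by split_ifs <;> simp
              split_ifs with hw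
              · obtain ⟨ω, hω⟩ := hcon w
                refine le_trans ?_ (single_le_sum hnn (mem_univ ω))
                rw [if_pos ⟨hw ω, hω (hw ω)⟩]
              · exact sum_nonneg hnn
          _ = ∑ ω, N (vertex u v ω) := by
              rw [expect_sum_comm]
              refine sum_congr rfl fun ω _ => ?_
              exact expect_affineEdges (fun w => if IsCorner X (vertex u v ω) w ∧
                cubeSum m g (vertex u v ω) w
                  ≠ cubeSum m g (vertex u v ω) (c (vertex u v ω)) then (1 : ℝ) else 0) ω
      have hlt : 2 ^ m * ∑ ω : Fin m → Fin 2, N (vertex u v ω) < 2 ^ m * (p / 2) := by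
        rw [mul_sum]
        calc ∑ ω : Fin m → Fin 2, 2 ^ m * N (vertex u v ω)
            < ∑ ω : Fin m → Fin 2, p / 2 :=
              sum_lt_sum_of_nonempty univ_nonempty fun ω _ => hNlt _
          _ = 2 ^ m * (p / 2) := by simp
      exact absurd (lt_of_mul_lt_mul_left hlt (by positivity)) (not_lt.2 hle)
    obtain ⟨w, hw⟩ := hex
    exact cubeSum_eq_zero_of_corners hg w (fun ω => (hw ω).1) fun ω => by rw [(hw ω).2]
  · have : cubeSum m g x (c x) = 0 := hg _ _ fun ω => by
      by_cases h : ω = 0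
      · rwa [h, vertex_zero]
      · exact hc x ω h
    simp [this]

end CubesOfCorners

end UniformExtension

theorem theorem1 (m : ℕ) (hm : 1 ≤ m) :
    ∃ C : ℕ, ∀ δ : ℝ, 0 < δ →
      ∀ (k : Type*) [Field k] [Finite k]
        (V : Type*) [AddCommGroup V] [Module k V] [Fintype V]
        (H : Type*) [AddCommGroup H]
        (X : Set V), δ < UniformExtension.density X →
        UniformExtension.IsUniform (δ ^ C) m X →
        ∀ f : X → H, (∀ c, UniformExtension.cubeSumOn m f c = 0) →
          ∃ h : V → H, (∀ u v, UniformExtension.cubeSum m h u v = 0) ∧ ∀ x : X, h x = f x := by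
  obtain ⟨C, hC⟩ := UniformExtension.exists_exponent (4 * 8 ^ m) (3 * 4 ^ m)
    (Nat.one_le_iff_ne_zero.2 (by positivity))
  refine ⟨C, fun δ hδ k _ _ V _ _ _ H _ X hX hu f hf => ?_⟩
  classical
  have hsmall := hC δ _ hδ hX (UniformExtension.density_le_one X) _
    (UniformExtension.uniformity_le_of_isUniform X hu) (UniformExtension.uniformity_le_two_mul X m)
  obtain ⟨h, h0, hh⟩ := UniformExtension.exists_extension
    -- The value off `X` is immaterial: it cancels in every prediction.
    (g := fun x => if hx : x ∈ X then f ⟨x, hx⟩ else 0) hm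
    (fun u v huv => by
      rw [← hf ⟨(u, v), huv⟩, UniformExtension.cubeSum, UniformExtension.cubeSumOn]
      exact Finset.sum_congr rfl fun ω _ => by rw [dif_pos (huv ω)])
    (by exact_mod_cast hsmall)
  exact ⟨h, h0, fun x => by rw [hh x x.2]; simp⟩
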